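/- Let $d\ge 2$ be an integer and, for $x\in(0,\infty)$, let $$V(x)=\frac{x^{2-d}-1}{d-2}+\frac{x^2-1}{2},$$ where the first term is replaced by $-\ln x$ when $d=2$. For every $E>0$ the equation $V(x)=E$ has exactly two solutions $x_1(E)<x_2(E)$ in $(0,\infty)$, and the integral $$T(E)=2\int_{x_1(E)}^{x_2(E)}\frac{\mathrm{d}x}{\sqrt{2\,(E-V(x))}},$$ which gives the period at energy level $E=\tfrac12v^2+V(x)$ of the Hamiltonian system $\dot x=v$, $\dot v=-V'(x)$, converges. The period function $T$ is non-constant on every non-degenerate sub-interval of $(0,\infty)$ if and only if $d\ne4$. Furthermore, if $d=4$, then $T(E)=\pi$ for all $E>0$. -/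

import Mathlib

open Set MeasureTheory

noncomputable section

/-- The potential `V(x) = (x^(2-d) - 1)/(d - 2) + (x^2 - 1)/2`, considered on `(0, ∞)`, where the
first term is replaced by `-ln x` when `d = 2`. -/
def potential (d : ℕ) (x : ℝ) : ℝ :=
  (if d = 2 then -Real.log x else (x ^ (2 - (d : ℤ)) - 1) / ((d : ℝ) - 2)) + (x ^ 2 - 1) / 2

/-- The set of the points of the domain `D` where the potential `V` takes the value `E`. -/
def turningPoints (V : ℝ → ℝ) (D : Set ℝ) (E : ℝ) : Set ℝ := {x | x ∈ D ∧ V x = E}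

/-- The left turning point `x₁(E)` of an orbit of energy `E`. -/
def leftTurningPoint (V : ℝ → ℝ) (D : Set ℝ) (E : ℝ) : ℝ := sInf (turningPoints V D E)

/-- The right turning point `x₂(E)` of an orbit of energy `E`. -/
def rightTurningPoint (V : ℝ → ℝ) (D : Set ℝ) (E : ℝ) : ℝ := sSup (turningPoints V D E)

/-- The period `T(E)` at energy level `E` of the Hamiltonian system `x' = v`, `v' = -V'(x)` on the
interval `D`, given by `T(E) / 2 = ∫ dx / √(2 (E - V(x)))` over `x₁(E) ≤ x ≤ x₂(E)`. -/
def period (V : ℝ → ℝ) (D : Set ℝ) (E : ℝ) : ℝ :=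
  2 * ∫ x in leftTurningPoint V D E..rightTurningPoint V D E, 1 / Real.sqrt (2 * (E - V x))

/-- `T` is non-constant on every (non-degenerate) sub-interval of `S`: intervals may be open,
closed, half-open, bounded or unbounded. -/
def NonconstantOnSubintervals (T : ℝ → ℝ) (S : Set ℝ) : Prop :=
  ∀ I : Set ℝ, I ⊆ S → I.OrdConnected → I.Nontrivial → ∃ E₁ ∈ I, ∃ E₂ ∈ I, T E₁ ≠ T E₂

end

/-!
Let `X h` be the turning point whose energy has the signed square root `h`, so that
`V (X h) = h ^ 2`. The substitution `x = X (r * sin θ)` removes the singularities of the period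
integral and gives `T (r ^ 2) = √2 * ∫ θ in -(π / 2)..π / 2, X' (r * sin θ)`.

In the coordinate `y = log x` the potential is analytic and proper on the whole line, hence `X` is
analytic. The power series of `X'` act on the Banach algebras `C(K, ℝ)`, so the integral is an
analytic function of `r ∈ ℝ`. If `T` is constant on some interval, then the integral is
constant on all of `ℝ`, and its Taylor coefficient of order two at `r = 0`, a positive multiple of
`X''' 0`, vanishes. Differentiating `V (X h) = h ^ 2` four times at `h = 0` yields
`6 * X''' 0 = X' 0 ^ 3 * (d - 1) * (d - 4)`, which leaves only `d = 4`.

For `d = 4` one has `V x = (x - x⁻¹) ^ 2 / 2`, which is invariant under `x ↦ x⁻¹`. Thus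
`X (-h) = (X h)⁻¹` and `X h - X (-h) = √2 * h`: the even part of `X'`, the only one that the
integral sees, is constant.
-/

open Filter Topology Real
open scoped ContDiff

theorem analyticAt_integral_continuousMap {K : Type*} [TopologicalSpace K] [CompactSpace K]
    [MeasurableSpace K] [BorelSpace K] {μ : Measure K} [IsFiniteMeasure μ]
    {E : Type*} [NormedAddCommGroup E] [NormedSpace ℝ E] {u : E → C(K, ℝ)} {e : E}
    (hu : AnalyticAt ℝ u e) : AnalyticAt ℝ (fun r => ∫ x, u r x ∂μ) e := by
  have hcomp : AnalyticAt ℝ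
      (fun r => L1.integralCLM (ContinuousMap.toLp 1 μ ℝ (u r) : Lp ℝ 1 μ)) e :=
    (L1.integralCLM.comp (ContinuousMap.toLp (E := ℝ) 1 μ ℝ)).analyticAt _ |>.comp hu
  refine hcomp.congr (Eventually.of_forall fun r => ?_)
  simp only [← L1.integral_eq, L1.integral_eq_integral]
  exact integral_congr_ae (ContinuousMap.coeFn_toLp μ (u r))

theorem exists_analyticAt_comp_continuousMap {K : Type*} [TopologicalSpace K] [CompactSpace K]
    [Nonempty K] {f : ℝ → ℝ} {p : FormalMultilinearSeries ℝ ℝ ℝ} {c : ℝ} {ε : NNReal}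
    (hf : HasFPowerSeriesOnBall f p c ε) :
    ∃ Φ : C(K, ℝ) → C(K, ℝ), ∀ u : C(K, ℝ), ‖u‖ < ε →
      AnalyticAt ℝ Φ u ∧ ∀ x, Φ u x = f (c + u x) := by
  set P := FormalMultilinearSeries.ofScalars C(K, ℝ) (𝕜 := ℝ) p.coeff with hP
  have hradius : ε ≤ P.radius := hf.r_le.trans <|
    FormalMultilinearSeries.radius_le_of_le fun {n} => by
      rw [hP, FormalMultilinearSeries.ofScalars_norm,
        FormalMultilinearSeries.norm_apply_eq_norm_coef]
  have hsum := P.hasFPowerSeriesOnBall (hf.r_pos.trans_le hradius)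
  refine ⟨P.sum, fun u hu => ?_⟩
  have hmem : u ∈ Metric.eball (0 : C(K, ℝ)) P.radius :=
    Metric.eball_subset_eball hradius (by simpa [Metric.eball_coe] using hu)
  refine ⟨hsum.analyticAt_of_mem hmem, fun x => ?_⟩
  have hPx : HasSum (fun n => (P n fun _ => u) x) (P.sum u x) := by
    have hPu : HasSum (fun n => P n fun _ => u) (P.sum u) := by simpa using hsum.hasSum hmem
    exact hPu.map (ContinuousMap.evalCLM ℝ x : C(K, ℝ) →L[ℝ] ℝ) (ContinuousLinearMap.continuous _)
  have hfx : HasSum (fun n => p n fun _ => u x) (f (c + u x)) :=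
    hf.hasSum (by simpa [Metric.eball_coe] using (u.norm_coe_le_norm x).trans_lt hu)
  refine hPx.unique (hfx.congr_fun fun n => ?_)
  simp [hP, FormalMultilinearSeries.ofScalars_apply_eq, mul_comm]

theorem analyticAt_integral_comp_of_hasFPowerSeriesOnBall {K : Type*} [TopologicalSpace K]
    [CompactSpace K] [MeasurableSpace K] [BorelSpace K] {μ : Measure K} [IsFiniteMeasure μ]
    {f : ℝ → ℝ} {p : FormalMultilinearSeries ℝ ℝ ℝ} {c : ℝ} {ε : NNReal}
    (hf : HasFPowerSeriesOnBall f p c ε) {s : K → ℝ} (hs : Continuous s) {r₀ : ℝ}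
    (hball : ∀ x, |r₀ * s x - c| < ε) :
    AnalyticAt ℝ (fun r => ∫ x, f (r * s x) ∂μ) r₀ := by
  cases isEmpty_or_nonempty K
  · simpa [integral_of_isEmpty] using analyticAt_const
  obtain ⟨Φ, hΦ⟩ := exists_analyticAt_comp_continuousMap (K := K) hf
  let u : ℝ → C(K, ℝ) := fun r => r • ⟨s, hs⟩ - ContinuousMap.const K c
  have hu : AnalyticAt ℝ u r₀ := by fun_prop
  have hnorm : ‖u r₀‖ < ε := by
    rw [ContinuousMap.norm_lt_iff _ (by exact_mod_cast hf.r_pos)]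
    simpa [u] using hball
  have hΦu : AnalyticAt ℝ (fun r => Φ (u r)) r₀ := (hΦ _ hnorm).1.comp hu
  refine (analyticAt_integral_continuousMap hΦu (μ := μ)).congr ?_
  filter_upwards [hu.continuousAt.norm.eventually (gt_mem_nhds hnorm)] with r hr
  simp [(hΦ _ hr).2, u]

theorem analyticAt_intervalIntegral_comp_of_hasFPowerSeriesOnBall
    {f : ℝ → ℝ} {p : FormalMultilinearSeries ℝ ℝ ℝ} {c : ℝ} {ε : NNReal}
    (hf : HasFPowerSeriesOnBall f p c ε) {s : ℝ → ℝ} (hs : Continuous s) {a b r₀ : ℝ}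
    (hab : a ≤ b) (hball : ∀ θ ∈ Icc a b, |r₀ * s θ - c| < ε) :
    AnalyticAt ℝ (fun r => ∫ θ in a..b, f (r * s θ)) r₀ := by
  have hsubtype : ∀ r, ∫ θ in a..b, f (r * s θ) =
      ∫ θ : Icc a b, f (r * s θ) ∂((volume.restrict (Icc a b)).comap (↑)) := fun r => by
    rw [integral_subtype_comap measurableSet_Icc fun θ => f (r * s θ),
      Measure.restrict_restrict_of_subset subset_rfl, intervalIntegral.integral_of_le hab,
      integral_Icc_eq_integral_Ioc]
  simp only [hsubtype]
  exact analyticAt_integral_comp_of_hasFPowerSeriesOnBall hf (by fun_prop) fun θ => hball θ θ.2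

theorem exists_hasFPowerSeriesOnBall_nnreal {𝕜 E F : Type*} [NontriviallyNormedField 𝕜]
    [NormedAddCommGroup E] [NormedSpace 𝕜 E] [NormedAddCommGroup F] [NormedSpace 𝕜 F]
    {f : E → F} {x : E} (hf : AnalyticAt 𝕜 f x) :
    ∃ (ε : NNReal) (p : FormalMultilinearSeries 𝕜 E F), HasFPowerSeriesOnBall f p x ε := by
  obtain ⟨p, r, hp⟩ := hf
  obtain ⟨ε, hε, hεr⟩ := ENNReal.lt_iff_exists_nnreal_btwn.1 hp.r_pos
  exact ⟨ε, p, hp.mono hε hεr.le⟩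

theorem contDiff_omega_intervalIntegral_comp_mul {f s : ℝ → ℝ} (hf : ContDiff ℝ ω f)
    (hs : Continuous s) {a b : ℝ} (hab : a ≤ b) :
    ContDiff ℝ ω (fun r => ∫ θ in a..b, f (r * s θ)) := by
  -- No single power series of `f` need converge on all of `{r₀ * s θ}`: cut `[a, b]` into pieces.
  refine contDiff_omega_iff_analyticOnNhd.2 fun r₀ _ => ?_
  choose ε p hp using fun c =>
    exists_hasFPowerSeriesOnBall_nnreal (hf.analyticOnNhd c (mem_univ c))
  let U : ℝ → Set (Icc a b) := fun c => {θ | |r₀ * s θ - c| < ε c}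
  have hU : ∀ c, IsOpen (U c) := fun c => isOpen_lt (by fun_prop) continuous_const
  have hcover : univ ⊆ ⋃ c, U c := fun θ _ => mem_iUnion.2
    ⟨r₀ * s θ, by simpa [U] using ENNReal.coe_pos.1 (hp (r₀ * s θ)).r_pos⟩
  obtain ⟨t, ht₀, htmono, ⟨m, htm⟩, htU⟩ := exists_monotone_Icc_subset_open_cover_Icc hab hU hcover
  have hsplit : ∀ r, ∫ θ in a..b, f (r * s θ) =
      ∑ k ∈ Finset.range m, ∫ θ in (t k : ℝ)..t (k + 1), f (r * s θ) := fun r => by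
    have hcont : Continuous fun θ => f (r * s θ) := hf.continuous.comp (by fun_prop)
    rw [intervalIntegral.sum_integral_adjacent_intervals (a := fun k => (t k : ℝ))
      fun k _ => hcont.intervalIntegrable _ _, ht₀, htm m le_rfl]
  simp only [hsplit]
  refine Finset.analyticAt_fun_sum _ fun k _ => ?_
  obtain ⟨c, hc⟩ := htU k
  exact analyticAt_intervalIntegral_comp_of_hasFPowerSeriesOnBall (hp c) hs
    (htmono (Nat.le_succ k)) fun θ hθ =>
      hc (show (⟨θ, (t k).2.1.trans hθ.1, hθ.2.trans (t (k + 1)).2.2⟩ : Icc a b) ∈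
        Icc (t k) (t (k + 1)) from hθ)

theorem analyticAt_dslope {𝕜 E : Type*} [NontriviallyNormedField 𝕜] [NormedAddCommGroup E]
    [NormedSpace 𝕜 E] {f : 𝕜 → E} {a x : 𝕜} (ha : AnalyticAt 𝕜 f a) (hx : AnalyticAt 𝕜 f x) :
    AnalyticAt 𝕜 (dslope f a) x := by
  rcases eq_or_ne x a with rfl | hxa
  · obtain ⟨p, hp⟩ := ha
    exact hp.has_fpower_series_dslope_fslope.analyticAt
  · have hslope : AnalyticAt 𝕜 (slope f a) x :=
      ((analyticAt_id.sub analyticAt_const).inv (sub_ne_zero.2 hxa)).smul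
        (hx.sub analyticAt_const)
    exact hslope.congr (dslope_eventuallyEq_slope_of_ne f hxa).symm

theorem exists_eq_taylor_add_sq_mul {f : ℝ → ℝ} (hf : ContDiff ℝ ω f) :
    ∃ K : ℝ → ℝ, ContDiff ℝ ω K ∧ (∀ y, f y = f 0 + deriv f 0 * y + y ^ 2 * K y) ∧
      2 * K 0 = deriv (deriv f) 0 := by
  have hdslope : ∀ g : ℝ → ℝ, ∀ y, g y = g 0 + y * dslope g 0 y := fun g y => by
    have := sub_smul_dslope g 0 y
    simp only [sub_zero, smul_eq_mul] at this
    linarith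
  set K := dslope (dslope f 0) 0
  have hfa : ∀ y, AnalyticAt ℝ f y := fun y => hf.analyticOnNhd y (mem_univ y)
  have hK : ContDiff ℝ ω K := contDiff_omega_iff_analyticOnNhd.2 fun y _ =>
    analyticAt_dslope (analyticAt_dslope (hfa 0) (hfa 0)) (analyticAt_dslope (hfa 0) (hfa y))
  have hfK : ∀ y, f y = f 0 + deriv f 0 * y + y ^ 2 * K y := fun y => by
    rw [hdslope f y, hdslope (dslope f 0) y, dslope_same]
    ring
  have hderiv : deriv f = fun y => deriv f 0 + (y * (2 * K y + y * deriv K y)) := by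
    funext y
    have hKy : HasDerivAt K (deriv K y) y := (hK.differentiable (by simp) y).hasDerivAt
    have h := (((hasDerivAt_id' y).const_mul (deriv f 0)).const_add (f 0)).fun_add
      ((hasDerivAt_pow 2 y).fun_mul hKy)
    rw [← funext hfK] at h
    rw [h.deriv]
    push_cast
    ring
  have hfactor : DifferentiableAt ℝ (fun y => 2 * K y + y * deriv K y) 0 := by
    have hK' : ContDiff ℝ ω (deriv K) := (contDiff_succ_iff_deriv (n := ω)).1 hK |>.2.2
    exact ((hK.differentiable (by simp) 0).const_mul 2).add
      (differentiableAt_id.mul (hK'.differentiable (by simp) 0))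
  refine ⟨K, hK, hfK, ?_⟩
  rw [hderiv]
  have := ((hasDerivAt_id' (0 : ℝ)).fun_mul hfactor.hasDerivAt).const_add (deriv f 0)
  rw [this.deriv]
  simp

theorem deriv_deriv_eq_zero_of_integral_comp_mul_sin_eq {f : ℝ → ℝ} (hf : ContDiff ℝ ω f)
    (hconst : ∀ r, ∫ θ in -(π / 2)..π / 2, f (r * sin θ) = π * f 0) :
    deriv (deriv f) 0 = 0 := by
  obtain ⟨K, hK, hfK, hK0⟩ := exists_eq_taylor_add_sq_mul hf
  set R : ℝ → ℝ := fun r => ∫ θ in -(π / 2)..π / 2, sin θ ^ 2 * K (r * sin θ) with hR_def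
  have hKc : Continuous K := hK.continuous
  have hexpand : ∀ r, π * f 0 = π * f 0 + r ^ 2 * R r := fun r => by
    calc π * f 0 = ∫ θ in -(π / 2)..π / 2, f (r * sin θ) := (hconst r).symm
      _ = ∫ θ in -(π / 2)..π / 2,
          (f 0 + deriv f 0 * r * sin θ + r ^ 2 * (sin θ ^ 2 * K (r * sin θ))) := by
        refine intervalIntegral.integral_congr fun θ _ => ?_
        simp only [hfK (r * sin θ)]
        ring
      _ = π * f 0 + r ^ 2 * R r := by
        rw [intervalIntegral.integral_add, intervalIntegral.integral_add]
        · simp [hR_def]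
        all_goals exact Continuous.intervalIntegrable (by fun_prop) _ _
  have hR : Continuous R := intervalIntegral.continuous_parametric_intervalIntegral_of_continuous'
    (by fun_prop) _ _
  have hR_eq : R = 0 := hR.ext_on (dense_compl_singleton 0) continuous_zero fun r hr => by
    simpa [pow_eq_zero_iff, show r ≠ 0 from hr] using hexpand r
  have hR0 : R 0 = π / 2 * K 0 := by
    simp [hR_def, integral_sin_sq]
  rw [← hK0]
  simpa [hR_eq, pi_ne_zero] using hR0.symm

/-- `X` parametrizes the configuration interval `D` by a signed square root of the energy: `X h` is
the turning point of energy `h ^ 2`, on the right of the minimum for `0 < h` and on its left for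
`h < 0`. -/
structure IsEnergyParametrization (V : ℝ → ℝ) (D : Set ℝ) (X : ℝ → ℝ) : Prop where
  contDiff : ContDiff ℝ 1 X
  deriv_pos : ∀ h, 0 < deriv X h
  range_eq : range X = D
  apply_eq_sq : ∀ h, V (X h) = h ^ 2

namespace IsEnergyParametrization

variable {V X : ℝ → ℝ} {D : Set ℝ}

theorem strictMono (hX : IsEnergyParametrization V D X) : StrictMono X :=
  strictMono_of_deriv_pos hX.deriv_pos

theorem hasDerivAt (hX : IsEnergyParametrization V D X) (h : ℝ) : HasDerivAt X (deriv X h) h :=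
  (hX.contDiff.differentiable one_ne_zero h).hasDerivAt

theorem continuous_deriv (hX : IsEnergyParametrization V D X) : Continuous (deriv X) :=
  hX.contDiff.continuous_deriv le_rfl

theorem mem (hX : IsEnergyParametrization V D X) (h : ℝ) : X h ∈ D :=
  hX.range_eq.subset (mem_range_self h)

theorem apply_zero_eq (hX : IsEnergyParametrization V D X) {x : ℝ} (hx : x ∈ D) (hVx : V x = 0) :
    X 0 = x := by
  obtain ⟨h, rfl⟩ := hX.range_eq.superset hx
  have hh : h ^ 2 = 0 := hX.apply_eq_sq h ▸ hVx
  rw [(pow_eq_zero_iff two_ne_zero).1 hh]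

theorem turningPoints_sq (hX : IsEnergyParametrization V D X) (r : ℝ) :
    turningPoints V D (r ^ 2) = {X (-r), X r} := by
  ext x
  simp only [turningPoints, ← hX.range_eq, mem_ofPred_eq, mem_insert_iff, mem_singleton_iff]
  constructor
  · rintro ⟨⟨h, rfl⟩, hV⟩
    rw [hX.apply_eq_sq, sq_eq_sq_iff_eq_or_eq_neg] at hV
    exact hV.symm.imp (congrArg X) (congrArg X)
  · rintro (rfl | rfl) <;> simp [hX.apply_eq_sq]

theorem leftTurningPoint_sq (hX : IsEnergyParametrization V D X) {r : ℝ} (hr : 0 ≤ r) :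
    leftTurningPoint V D (r ^ 2) = X (-r) := by
  rw [leftTurningPoint, hX.turningPoints_sq, csInf_pair]
  exact inf_eq_left.2 (hX.strictMono.monotone (neg_le_self hr))

theorem rightTurningPoint_sq (hX : IsEnergyParametrization V D X) {r : ℝ} (hr : 0 ≤ r) :
    rightTurningPoint V D (r ^ 2) = X r := by
  rw [rightTurningPoint, hX.turningPoints_sq, csSup_pair]
  exact sup_eq_right.2 (hX.strictMono.monotone (neg_le_self hr))

theorem strictMonoOn_comp_mul_sin (hX : IsEnergyParametrization V D X) {r : ℝ} (hr : 0 < r) :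
    StrictMonoOn (fun θ => X (r * sin θ)) (Icc (-(π / 2)) (π / 2)) :=
  fun _ hθ _ hθ' hlt =>
    hX.strictMono (mul_lt_mul_of_pos_left (strictMonoOn_sin hθ hθ' hlt) hr)

theorem image_comp_mul_sin (hX : IsEnergyParametrization V D X) {r : ℝ} (hr : 0 < r) :
    (fun θ => X (r * sin θ)) '' Ioo (-(π / 2)) (π / 2) = Ioo (X (-r)) (X r) := by
  have hcont : Continuous fun θ => X (r * sin θ) := hX.contDiff.continuous.comp (by fun_prop)
  simpa using hcont.continuousOn.image_Ioo_of_strictMonoOn (by linarith [pi_pos])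
    (hX.strictMonoOn_comp_mul_sin hr)

theorem hasDerivAt_comp_mul_sin (hX : IsEnergyParametrization V D X) (r θ : ℝ) :
    HasDerivAt (fun θ => X (r * sin θ)) (deriv X (r * sin θ) * (r * cos θ)) θ :=
  (hX.hasDerivAt _).comp θ ((hasDerivAt_sin θ).const_mul r)

theorem sqrt_two_mul_sub_comp_mul_sin (hX : IsEnergyParametrization V D X) {r θ : ℝ} (hr : 0 ≤ r)
    (hθ : 0 ≤ cos θ) : √(2 * (r ^ 2 - V (X (r * sin θ)))) = √2 * (r * cos θ) := by
  rw [hX.apply_eq_sq, show 2 * (r ^ 2 - (r * sin θ) ^ 2) = 2 * (r * cos θ) ^ 2 by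
    rw [mul_pow, mul_pow, cos_sq']; ring, sqrt_mul zero_le_two, sqrt_sq (mul_nonneg hr hθ)]

theorem deriv_comp_mul_sin_smul (hX : IsEnergyParametrization V D X) {r θ : ℝ} (hr : 0 < r)
    (hθ : θ ∈ Ioo (-(π / 2)) (π / 2)) :
    (deriv X (r * sin θ) * (r * cos θ)) • (1 / √(2 * (r ^ 2 - V (X (r * sin θ))))) =
      (√2)⁻¹ * deriv X (r * sin θ) := by
  have hcos : 0 < cos θ := cos_pos_of_mem_Ioo hθ
  rw [hX.sqrt_two_mul_sub_comp_mul_sin hr.le hcos.le, smul_eq_mul]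
  field_simp

theorem intervalIntegrable (hX : IsEnergyParametrization V D X) {r : ℝ} (hr : 0 < r) :
    IntervalIntegrable (fun x => 1 / √(2 * (r ^ 2 - V x))) volume (X (-r)) (X r) := by
  have hcont : Continuous fun θ => (√2)⁻¹ * deriv X (r * sin θ) :=
    (hX.continuous_deriv.comp (by fun_prop)).const_mul _
  rw [intervalIntegrable_iff_integrableOn_Ioo_of_le (hX.strictMono.monotone (by linarith)),
    ← hX.image_comp_mul_sin hr, integrableOn_image_iff_integrableOn_deriv_smul_of_monotoneOn
      measurableSet_Ioo (fun θ _ => (hX.hasDerivAt_comp_mul_sin r θ).hasDerivWithinAt)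
      ((hX.strictMonoOn_comp_mul_sin hr).mono Ioo_subset_Icc_self).monotoneOn,
    integrableOn_congr_fun (fun θ hθ => hX.deriv_comp_mul_sin_smul hr hθ) measurableSet_Ioo]
  exact hcont.integrableOn_Icc.mono_set Ioo_subset_Icc_self

theorem period_sq (hX : IsEnergyParametrization V D X) {r : ℝ} (hr : 0 < r) :
    period V D (r ^ 2) = √2 * ∫ θ in -(π / 2)..π / 2, deriv X (r * sin θ) := by
  have hsubst : ∫ x in X (-r)..X r, 1 / √(2 * (r ^ 2 - V x)) =
      (√2)⁻¹ * ∫ θ in -(π / 2)..π / 2, deriv X (r * sin θ) := by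
    rw [intervalIntegral.integral_of_le (hX.strictMono.monotone (by linarith)),
      integral_Ioc_eq_integral_Ioo, ← hX.image_comp_mul_sin hr,
      integral_image_eq_integral_deriv_smul_of_monotoneOn measurableSet_Ioo
        (fun θ _ => (hX.hasDerivAt_comp_mul_sin r θ).hasDerivWithinAt)
        ((hX.strictMonoOn_comp_mul_sin hr).mono Ioo_subset_Icc_self).monotoneOn,
      setIntegral_congr_fun measurableSet_Ioo fun θ hθ => hX.deriv_comp_mul_sin_smul hr hθ,
      ← integral_Ioc_eq_integral_Ioo, ← intervalIntegral.integral_of_le (by linarith [pi_pos]),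
      intervalIntegral.integral_const_mul]
  rw [period, hX.leftTurningPoint_sq hr.le, hX.rightTurningPoint_sq hr.le, hsubst, ← mul_assoc,
    ← div_eq_mul_inv, div_sqrt]

theorem period_wellDefined (hX : IsEnergyParametrization V D X) {E : ℝ} (hE : 0 < E) :
    leftTurningPoint V D E < rightTurningPoint V D E ∧
      turningPoints V D E = {leftTurningPoint V D E, rightTurningPoint V D E} ∧
      IntervalIntegrable (fun x => 1 / √(2 * (E - V x))) volume
        (leftTurningPoint V D E) (rightTurningPoint V D E) := by
  obtain ⟨r, hr, rfl⟩ : ∃ r, 0 < r ∧ r ^ 2 = E := ⟨√E, sqrt_pos.2 hE, sq_sqrt hE.le⟩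
  rw [hX.leftTurningPoint_sq hr.le, hX.rightTurningPoint_sq hr.le]
  exact ⟨hX.strictMono (by linarith), hX.turningPoints_sq r, hX.intervalIntegrable hr⟩

theorem of_comp {φ : ℝ → ℝ} (hφ : ContDiff ℝ 1 φ) (hφ_pos : ∀ y, 0 < deriv φ y)
    (hX : IsEnergyParametrization (V ∘ φ) univ X) :
    IsEnergyParametrization V (range φ) (φ ∘ X) where
  contDiff := hφ.comp hX.contDiff
  deriv_pos h := by
    rw [deriv_comp h (hφ.differentiable one_ne_zero _) (hX.hasDerivAt h).differentiableAt]
    exact mul_pos (hφ_pos _) (hX.deriv_pos h)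
  range_eq := by rw [range_comp, hX.range_eq, image_univ]
  apply_eq_sq := hX.apply_eq_sq

theorem period_eq_of_sub_eq (hX : IsEnergyParametrization V D X) {c : ℝ}
    (hwidth : ∀ r, 0 ≤ r → X r - X (-r) = c * r) {E : ℝ} (hE : 0 < E) :
    period V D E = c * π / √2 := by
  obtain ⟨r, hr, rfl⟩ : ∃ r, 0 < r ∧ r ^ 2 = E := ⟨√E, sqrt_pos.2 hE, sq_sqrt hE.le⟩
  have hwidth_odd : ∀ h, X h - X (-h) = c * h := fun h => by
    rcases le_total 0 h with hh | hh
    · exact hwidth h hh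
    · have := hwidth (-h) (neg_nonneg.2 hh)
      rw [neg_neg] at this
      linarith
  have hderiv : ∀ h, deriv X h + deriv X (-h) = c := fun h => by
    have hleft := (hX.hasDerivAt h).sub ((hX.hasDerivAt (-h)).comp h (hasDerivAt_neg h))
    have hright := (hasDerivAt_id h).const_mul c
    simpa using hleft.unique (hright.congr_of_eventuallyEq (.of_forall hwidth_odd))
  have hint : ∀ ε : ℝ, IntervalIntegrable (fun θ => deriv X (ε * (r * sin θ))) volume
      (-(π / 2)) (π / 2) := fun ε =>
    (hX.continuous_deriv.comp (by fun_prop)).intervalIntegrable _ _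
  have hreflect : ∫ θ in -(π / 2)..π / 2, deriv X (-(r * sin θ)) =
      ∫ θ in -(π / 2)..π / 2, deriv X (r * sin θ) := by
    simpa using intervalIntegral.integral_comp_neg (a := -(π / 2)) (b := π / 2)
      fun θ => deriv X (r * sin θ)
  have htwice : 2 * ∫ θ in -(π / 2)..π / 2, deriv X (r * sin θ) = c * π := by
    calc 2 * ∫ θ in -(π / 2)..π / 2, deriv X (r * sin θ)
      _ = ∫ θ in -(π / 2)..π / 2, (deriv X (r * sin θ) + deriv X (-(r * sin θ))) := by
        rw [intervalIntegral.integral_add (by simpa using hint 1) (by simpa using hint (-1)),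
          hreflect, two_mul]
      _ = c * π := by
        simp only [hderiv, intervalIntegral.integral_const, smul_eq_mul]
        ring
  rw [hX.period_sq hr, ← htwice, eq_div_iff (by positivity), mul_right_comm,
    mul_self_sqrt zero_le_two]

theorem nonconstantOnSubintervals_period (hX : IsEnergyParametrization V D X)
    (hXω : ContDiff ℝ ω X) (hX3 : iteratedDeriv 3 X 0 ≠ 0) :
    NonconstantOnSubintervals (period V D) (Ioi 0) := by
  intro I hI hIord hInt
  by_contra! hconst
  obtain ⟨E₁, hE₁, E₂, hE₂, hlt⟩ := hInt.exists_lt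
  have hE₁_pos : 0 < E₁ := hI hE₁
  have hX' : ContDiff ℝ ω (deriv X) := (contDiff_succ_iff_deriv (n := ω)).1 hXω |>.2.2
  set G : ℝ → ℝ := fun r => ∫ θ in -(π / 2)..π / 2, deriv X (r * sin θ) with hG_def
  have hG : ContDiff ℝ ω G :=
    contDiff_omega_intervalIntegral_comp_mul hX' continuous_sin (by linarith [pi_pos])
  have hG_eqOn : EqOn G (fun _ => (√2)⁻¹ * period V D E₁) (Ioo √E₁ √E₂) := fun r hr => by
    have hr_pos : 0 < r := (sqrt_nonneg _).trans_lt hr.1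
    have hr_sq : r ^ 2 ∈ I := hIord.out hE₁ hE₂
      ⟨((sqrt_lt' hr_pos).1 hr.1).le, ((lt_sqrt hr_pos.le).1 hr.2).le⟩
    rw [hconst E₁ hE₁ (r ^ 2) hr_sq, hX.period_sq hr_pos, inv_mul_cancel_left₀ (by positivity)]
  obtain ⟨r₀, hr₀⟩ := nonempty_Ioo.2 (sqrt_lt_sqrt hE₁_pos.le hlt)
  have hG_const : G = fun _ => (√2)⁻¹ * period V D E₁ :=
    AnalyticOnNhd.eq_of_eventuallyEq (contDiff_omega_iff_analyticOnNhd.1 hG) analyticOnNhd_const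
      (hG_eqOn.eventuallyEq_of_mem (isOpen_Ioo.mem_nhds hr₀))
  refine hX3 ?_
  rw [iteratedDeriv_succ', iteratedDeriv_succ', iteratedDeriv_one]
  refine deriv_deriv_eq_zero_of_integral_comp_mul_sin_eq hX' fun r => ?_
  calc G r = G 0 := by rw [hG_const]
    _ = π * deriv X 0 := by simp [hG_def]

theorem hasDerivAt_comp (hX : IsEnergyParametrization V D X) {U U' : ℝ → ℝ}
    (hU : ∀ x ∈ D, HasDerivAt U (U' x) x) (h : ℝ) :
    HasDerivAt (fun h => U (X h)) (U' (X h) * deriv X h) h :=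
  (hU _ (hX.mem h)).comp h (hX.hasDerivAt h)

theorem energy_jet_zero (hX : IsEnergyParametrization V D X) (hX4 : ContDiff ℝ 4 X)
    {V₁ V₂ V₃ V₄ : ℝ → ℝ} (hV : ∀ x ∈ D, HasDerivAt V (V₁ x) x)
    (hV₁ : ∀ x ∈ D, HasDerivAt V₁ (V₂ x) x) (hV₂ : ∀ x ∈ D, HasDerivAt V₂ (V₃ x) x)
    (hV₃ : ∀ x ∈ D, HasDerivAt V₃ (V₄ x) x) :
    V₁ (X 0) * deriv X 0 = 0 ∧
    V₃ (X 0) * deriv X 0 ^ 3 + 3 * V₂ (X 0) * deriv X 0 * iteratedDeriv 2 X 0 +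
      V₁ (X 0) * iteratedDeriv 3 X 0 = 0 ∧
    V₄ (X 0) * deriv X 0 ^ 4 + 6 * V₃ (X 0) * deriv X 0 ^ 2 * iteratedDeriv 2 X 0 +
      3 * V₂ (X 0) * iteratedDeriv 2 X 0 ^ 2 + 4 * V₂ (X 0) * deriv X 0 * iteratedDeriv 3 X 0 +
      V₁ (X 0) * iteratedDeriv 4 X 0 = 0 := by
  have hiter : ∀ k < 4, ∀ h, HasDerivAt (iteratedDeriv k X) (iteratedDeriv (k + 1) X h) h := by
    intro k hk h
    rw [iteratedDeriv_succ]
    exact (hX4.differentiable_iteratedDeriv k (by exact_mod_cast hk) h).hasDerivAt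
  have hd₁ : ∀ h, HasDerivAt (deriv X) (iteratedDeriv 2 X h) h := by
    simpa using hiter 1 (by norm_num)
  have hd₂ := hiter 2 (by norm_num)
  have hd₃ := hiter 3 (by norm_num)
  have hderiv_unique : ∀ {f g f' g' : ℝ → ℝ}, (∀ h, f h = g h) → (∀ h, HasDerivAt f (f' h) h) →
      (∀ h, HasDerivAt g (g' h) h) → ∀ h, f' h = g' h := fun hfg hf hg h =>
    (hf h).unique (funext hfg ▸ hg h)
  have hjet₁ : ∀ h, V₁ (X h) * deriv X h = 2 * h :=
    hderiv_unique hX.apply_eq_sq (hX.hasDerivAt_comp hV) fun h => by simpa using hasDerivAt_pow 2 h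
  have hjet₂ : ∀ h, V₂ (X h) * deriv X h ^ 2 + V₁ (X h) * iteratedDeriv 2 X h = 2 := fun h => by
    linear_combination hderiv_unique hjet₁
      (fun h => (hX.hasDerivAt_comp hV₁ h).fun_mul (hd₁ h))
      (fun h => (hasDerivAt_id' h).const_mul 2) h
  have hjet₃ : ∀ h, V₃ (X h) * deriv X h ^ 3 + 3 * V₂ (X h) * deriv X h * iteratedDeriv 2 X h +
      V₁ (X h) * iteratedDeriv 3 X h = 0 := fun h => by
    linear_combination hderiv_unique hjet₂
      (fun h => ((hX.hasDerivAt_comp hV₂ h).fun_mul ((hd₁ h).fun_pow 2)).fun_add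
        ((hX.hasDerivAt_comp hV₁ h).fun_mul (hd₂ h)))
      (fun h => hasDerivAt_const h 2) h
  refine ⟨by simpa using hjet₁ 0, hjet₃ 0, ?_⟩
  linear_combination hderiv_unique hjet₃
    (fun h => (((hX.hasDerivAt_comp hV₃ h).fun_mul ((hd₁ h).fun_pow 3)).fun_add
      ((((hX.hasDerivAt_comp hV₂ h).const_mul 3).fun_mul (hd₁ h)).fun_mul (hd₂ h))).fun_add
        ((hX.hasDerivAt_comp hV₁ h).fun_mul (hd₃ h)))
    (fun h => hasDerivAt_const h 0) 0

theorem mul_iteratedDeriv_three_zero_eq (hX : IsEnergyParametrization V D X) (hX4 : ContDiff ℝ 4 X)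
    {V₁ V₂ V₃ V₄ : ℝ → ℝ} (hV : ∀ x ∈ D, HasDerivAt V (V₁ x) x)
    (hV₁ : ∀ x ∈ D, HasDerivAt V₁ (V₂ x) x) (hV₂ : ∀ x ∈ D, HasDerivAt V₂ (V₃ x) x)
    (hV₃ : ∀ x ∈ D, HasDerivAt V₃ (V₄ x) x) :
    12 * V₂ (X 0) ^ 2 * iteratedDeriv 3 X 0 =
      deriv X 0 ^ 3 * (5 * V₃ (X 0) ^ 2 - 3 * V₂ (X 0) * V₄ (X 0)) := by
  obtain ⟨hjet₁, hjet₃, hjet₄⟩ := hX.energy_jet_zero hX4 hV hV₁ hV₂ hV₃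
  have hX1 : deriv X 0 ≠ 0 := (hX.deriv_pos 0).ne'
  have hV₁0 : V₁ (X 0) = 0 := (mul_eq_zero.1 hjet₁).resolve_right hX1
  have hjet₃' : V₃ (X 0) * deriv X 0 ^ 2 + 3 * V₂ (X 0) * iteratedDeriv 2 X 0 = 0 := by
    refine mul_left_cancel₀ hX1 ?_
    linear_combination hjet₃ - iteratedDeriv 3 X 0 * hV₁0
  refine mul_left_cancel₀ hX1 ?_
  linear_combination 3 * V₂ (X 0) * (hjet₄ - iteratedDeriv 4 X 0 * hV₁0) -
    (5 * V₃ (X 0) * deriv X 0 ^ 2 + 3 * V₂ (X 0) * iteratedDeriv 2 X 0) * hjet₃'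

end IsEnergyParametrization

theorem pos_of_mul_deriv_pos {W : ℝ → ℝ} (hW : Differentiable ℝ W) (hW0 : W 0 = 0)
    (hderiv : ∀ y, y ≠ 0 → 0 < y * deriv W y) {y : ℝ} (hy : y ≠ 0) : 0 < W y := by
  rcases hy.lt_or_gt with hy | hy
  · have hanti : StrictAntiOn W (Iic 0) := strictAntiOn_of_deriv_neg (convex_Iic 0)
      hW.continuous.continuousOn fun x hx => by
        rw [interior_Iic] at hx
        exact neg_of_mul_pos_right (hderiv x (ne_of_lt hx)) (le_of_lt hx)
    simpa [hW0] using hanti hy.le self_mem_Iic hy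
  · have hmono : StrictMonoOn W (Ici 0) := strictMonoOn_of_deriv_pos (convex_Ici 0)
      hW.continuous.continuousOn fun x hx => by
        rw [interior_Ici] at hx
        exact pos_of_mul_pos_right (hderiv x (ne_of_gt hx)) (le_of_lt hx)
    simpa [hW0] using hmono self_mem_Ici hy.le hy

theorem exists_contDiff_sq_eq {W : ℝ → ℝ} (hW : ContDiff ℝ ω W) (hW0 : W 0 = 0)
    (hderiv : ∀ y, y ≠ 0 → 0 < y * deriv W y) (hderiv2 : 0 < deriv (deriv W) 0) :
    ∃ H : ℝ → ℝ, ContDiff ℝ ω H ∧ H 0 = 0 ∧ (∀ y, 0 < deriv H y) ∧ ∀ y, H y ^ 2 = W y := by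
  have hWd : Differentiable ℝ W := hW.differentiable (by simp)
  have hpos : ∀ y, y ≠ 0 → 0 < W y := fun y => pos_of_mul_deriv_pos hWd hW0 hderiv
  have hWmin : IsLocalMin W 0 := .of_forall fun y => by
    rcases eq_or_ne y 0 with rfl | hy
    exacts [le_rfl, hW0.trans_le (hpos y hy).le]
  obtain ⟨K, hK, hWK, hK0⟩ := exists_eq_taylor_add_sq_mul hW
  simp only [hW0, hWmin.deriv_eq_zero, zero_mul, add_zero, zero_add] at hWK
  have hKpos : ∀ y, 0 < K y := fun y => by
    rcases eq_or_ne y 0 with rfl | hy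
    · linarith
    · exact pos_of_mul_pos_right (hWK y ▸ hpos y hy) (sq_nonneg y)
  have hsqrt : ContDiff ℝ ω fun y => √(K y) := hK.sqrt fun y => (hKpos y).ne'
  set H : ℝ → ℝ := fun y => y * √(K y) with hH_def
  have hH : ContDiff ℝ ω H := contDiff_id.mul hsqrt
  have hH_sq : ∀ y, H y ^ 2 = W y := fun y => by rw [hH_def, mul_pow, sq_sqrt (hKpos y).le, hWK]
  refine ⟨H, hH, zero_mul _, fun y => ?_, hH_sq⟩
  have hHy : HasDerivAt H (deriv H y) y := (hH.differentiable (by simp) y).hasDerivAt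
  rcases eq_or_ne y 0 with rfl | hy
  · have h := (hasDerivAt_id' (0 : ℝ)).fun_mul (hsqrt.differentiable (by simp) 0).hasDerivAt
    rw [h.deriv]
    simpa using hKpos 0
  · have hWy : deriv W y = 2 * (y * √(K y)) * deriv H y := by
      rw [← funext hH_sq, (hHy.fun_pow 2).deriv]
      simp [hH_def]
    have hprod : 0 < (2 * y ^ 2 * √(K y)) * deriv H y := by
      calc 0 < y * deriv W y := hderiv y hy
        _ = (2 * y ^ 2 * √(K y)) * deriv H y := by rw [hWy]; ring
    exact pos_of_mul_pos_right hprod (by positivity)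

theorem surjective_of_tendsto_sq_cocompact {H : ℝ → ℝ} (hcont : Continuous H) (hmono : Monotone H)
    (hH0 : H 0 = 0) (hlim : Tendsto (fun y => H y ^ 2) (cocompact ℝ) atTop) :
    Function.Surjective H := by
  have habs : Tendsto (fun y => |H y|) (cocompact ℝ) atTop := by
    simpa only [Function.comp_def, sqrt_sq_eq_abs] using tendsto_sqrt_atTop.comp hlim
  rw [cocompact_eq_atBot_atTop, tendsto_sup] at habs
  refine hcont.surjective (habs.2.congr' ?_) (tendsto_neg_atTop_iff.1 (habs.1.congr' ?_))
  · filter_upwards [eventually_ge_atTop 0] with y hy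
    exact abs_of_nonneg (hH0 ▸ hmono hy)
  · filter_upwards [eventually_le_atBot 0] with y hy
    exact abs_of_nonpos (hH0 ▸ hmono hy)

theorem exists_contDiff_inverse {n : WithTop ℕ∞} {H : ℝ → ℝ} (hH : ContDiff ℝ n H) (hn : n ≠ 0)
    (hpos : ∀ y, 0 < deriv H y) (hsurj : Function.Surjective H) :
    ∃ Y : ℝ → ℝ, ContDiff ℝ n Y ∧ (∀ y, Y (H y) = y) ∧ ∀ h, H (Y h) = h := by
  let e : ℝ ≃o ℝ := (strictMono_of_deriv_pos hpos).orderIsoOfSurjective H hsurj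
  exact ⟨e.symm, e.toHomeomorph.contDiff_symm_deriv (fun y => (hpos y).ne')
    (fun y => (hH.differentiable hn y).hasDerivAt) hH, e.symm_apply_apply, e.apply_symm_apply⟩

theorem exists_isEnergyParametrization {W : ℝ → ℝ} (hW : ContDiff ℝ ω W) (hW0 : W 0 = 0)
    (hderiv : ∀ y, y ≠ 0 → 0 < y * deriv W y) (hderiv2 : 0 < deriv (deriv W) 0)
    (hlim : Tendsto W (cocompact ℝ) atTop) :
    ∃ Y : ℝ → ℝ, ContDiff ℝ ω Y ∧ IsEnergyParametrization W univ Y := by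
  obtain ⟨H, hH, hH0, hHpos, hH_sq⟩ := exists_contDiff_sq_eq hW hW0 hderiv hderiv2
  have hsurj : Function.Surjective H := surjective_of_tendsto_sq_cocompact
    hH.continuous (strictMono_of_deriv_pos hHpos).monotone hH0 (by simpa only [hH_sq] using hlim)
  obtain ⟨Y, hY, hYH, hHY⟩ := exists_contDiff_inverse hH (by simp) hHpos hsurj
  refine ⟨Y, hY, hY.of_le le_top, fun h => ?_,
    (Function.RightInverse.surjective hYH).range_eq, fun h => by rw [← hH_sq, hHY]⟩
  have hcomp := ((hH.differentiable (by simp) (Y h)).hasDerivAt.comp h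
    (hY.differentiable (by simp) h).hasDerivAt).unique
    ((hasDerivAt_id h).congr_of_eventuallyEq (.of_forall hHY))
  exact pos_of_mul_pos_right (hcomp ▸ one_pos) (hHpos (Y h)).le

/-- The potential `potential d` for a real parameter `d`: the integer power becomes a real one. -/
noncomputable def powerPotential (d x : ℝ) : ℝ :=
  (if d = 2 then -log x else (x ^ (2 - d) - 1) / (d - 2)) + (x ^ 2 - 1) / 2

theorem potential_eq_powerPotential (d : ℕ) : potential d = powerPotential d := by
  funext x
  have hcast : x ^ (2 - (d : ℝ)) = x ^ (2 - (d : ℤ)) := by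
    rw [← rpow_intCast]
    push_cast
    rfl
  have hd : (d : ℝ) = 2 ↔ d = 2 := by norm_cast
  simp only [potential, powerPotential, hcast, hd]

theorem hasDerivAt_powerPotential (d : ℝ) {x : ℝ} (hx : 0 < x) :
    HasDerivAt (powerPotential d) (x - x ^ (1 - d)) x := by
  have hquad : HasDerivAt (fun x : ℝ => (x ^ 2 - 1) / 2) x x := by
    simpa using ((hasDerivAt_pow 2 x).sub_const 1).div_const 2
  have hrep : HasDerivAt (fun x => if d = 2 then -log x else (x ^ (2 - d) - 1) / (d - 2))
      (-x ^ (1 - d)) x := by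
    split_ifs with hd
    · refine (hasDerivAt_log hx.ne').fun_neg.congr_deriv ?_
      rw [hd, show (1 - 2 : ℝ) = -1 by norm_num, rpow_neg_one]
    · refine (((hasDerivAt_rpow_const (p := 2 - d) (.inl hx.ne')).sub_const 1).div_const
        (d - 2)).congr_deriv ?_
      rw [show 2 - d - 1 = 1 - d by ring, div_eq_iff (sub_ne_zero.2 hd)]
      ring
  exact (hrep.fun_add hquad).congr_deriv (neg_add_eq_sub _ _)

theorem contDiffAt_powerPotential (d : ℝ) {x : ℝ} (hx : 0 < x) :
    ContDiffAt ℝ ω (powerPotential d) x := by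
  have hrep :
      ContDiffAt ℝ ω (fun x => if d = 2 then -log x else (x ^ (2 - d) - 1) / (d - 2)) x := by
    split_ifs
    · exact (contDiffAt_log.2 hx.ne').neg
    · exact ((contDiffAt_rpow_const_of_ne hx.ne').sub contDiffAt_const).div_const _
  exact hrep.add (by fun_prop)

theorem sub_log_le_powerPotential {d x : ℝ} (hd : 2 ≤ d) (hx : 0 < x) :
    (x ^ 2 - 1) / 2 - log x ≤ powerPotential d x := by
  rw [powerPotential, sub_eq_neg_add]
  gcongr
  split_ifs with hd2
  · rfl
  · have hd' : 0 < d - 2 := sub_pos.2 (hd.lt_of_ne' hd2)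
    rw [le_div_iff₀ hd', rpow_def_of_pos hx]
    linarith [add_one_le_exp (log x * (2 - d))]

theorem abs_sub_le_powerPotential_exp {d : ℝ} (hd : 2 ≤ d) (y : ℝ) :
    |y| - 1 / 2 ≤ powerPotential d (exp y) := by
  refine le_trans ?_ (sub_log_le_powerPotential hd (exp_pos y))
  rw [log_exp]
  rcases le_total 0 y with hy | hy
  · rw [abs_of_nonneg hy]
    nlinarith [add_one_le_exp y, sq_nonneg (y - 1)]
  · rw [abs_of_nonpos hy]
    nlinarith [exp_pos y]

theorem hasDerivAt_powerPotential_comp_exp (d y : ℝ) :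
    HasDerivAt (powerPotential d ∘ exp) (exp (2 * y) - exp ((2 - d) * y)) y := by
  refine ((hasDerivAt_powerPotential d (exp_pos y)).comp y (hasDerivAt_exp y)).congr_deriv ?_
  rw [← exp_mul, sub_mul, ← exp_add, ← exp_add]
  ring_nf

theorem deriv_powerPotential_comp_exp (d : ℝ) :
    deriv (powerPotential d ∘ exp) = fun y => exp (2 * y) - exp ((2 - d) * y) :=
  funext fun y => (hasDerivAt_powerPotential_comp_exp d y).deriv

theorem mul_deriv_powerPotential_comp_exp_pos {d y : ℝ} (hd : 0 < d) (hy : y ≠ 0) :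
    0 < y * deriv (powerPotential d ∘ exp) y := by
  rw [deriv_powerPotential_comp_exp]
  rcases hy.lt_or_gt with hy | hy
  · exact mul_pos_of_neg_of_neg hy (sub_neg.2 (exp_lt_exp.2 (by nlinarith)))
  · exact mul_pos hy (sub_pos.2 (exp_lt_exp.2 (by nlinarith)))

theorem deriv_deriv_powerPotential_comp_exp_zero (d : ℝ) :
    deriv (deriv (powerPotential d ∘ exp)) 0 = d := by
  have hexp : ∀ c : ℝ, HasDerivAt (fun y => exp (c * y)) c 0 := fun c => by
    simpa using ((hasDerivAt_id' (0 : ℝ)).const_mul c).exp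
  rw [deriv_powerPotential_comp_exp, ((hexp 2).fun_sub (hexp (2 - d))).deriv, sub_sub_cancel]

theorem tendsto_powerPotential_comp_exp_cocompact {d : ℝ} (hd : 2 ≤ d) :
    Tendsto (powerPotential d ∘ exp) (cocompact ℝ) atTop :=
  tendsto_atTop_mono (abs_sub_le_powerPotential_exp hd)
    (tendsto_atTop_add_const_right _ _ (tendsto_norm_cocompact_atTop (E := ℝ)))

theorem powerPotential_one (d : ℝ) : powerPotential d 1 = 0 := by
  simp [powerPotential]

theorem exists_isEnergyParametrization_powerPotential {d : ℝ} (hd : 2 ≤ d) :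
    ∃ X : ℝ → ℝ, ContDiff ℝ ω X ∧ IsEnergyParametrization (powerPotential d) (Ioi 0) X := by
  have hd0 : 0 < d := zero_lt_two.trans_le hd
  have hcontDiff : ContDiff ℝ ω (powerPotential d ∘ exp) := contDiff_iff_contDiffAt.2 fun y =>
    (contDiffAt_powerPotential d (exp_pos y)).comp y contDiff_exp.contDiffAt
  obtain ⟨Y, hY, hYpar⟩ := exists_isEnergyParametrization hcontDiff
    (by simp [powerPotential_one])
    (fun y hy => mul_deriv_powerPotential_comp_exp_pos hd0 hy)
    ((deriv_deriv_powerPotential_comp_exp_zero d).symm ▸ hd0)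
    (tendsto_powerPotential_comp_exp_cocompact hd)
  refine ⟨exp ∘ Y, contDiff_exp.comp hY, ?_⟩
  rw [← range_exp]
  exact hYpar.of_comp contDiff_exp fun y => by simpa using exp_pos y

theorem powerPotential_four {x : ℝ} (hx : 0 < x) : powerPotential 4 x = (x - x⁻¹) ^ 2 / 2 := by
  have hpow : x ^ (2 - 4 : ℝ) = (x ^ 2)⁻¹ := by
    rw [show (2 - 4 : ℝ) = -(2 : ℕ) by norm_num, rpow_neg hx.le, rpow_natCast]
  rw [powerPotential, if_neg (by norm_num), hpow]
  field_simp
  ring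

theorem energyParametrization_powerPotential_four_neg {X : ℝ → ℝ}
    (hX : IsEnergyParametrization (powerPotential 4) (Ioi 0) X) (h : ℝ) : X (-h) = (X h)⁻¹ := by
  have hinv_pos : 0 < (X h)⁻¹ := inv_pos.2 (hX.mem h)
  have hmem : (X h)⁻¹ ∈ turningPoints (powerPotential 4) (Ioi 0) (h ^ 2) := by
    refine ⟨hinv_pos, ?_⟩
    rw [← hX.apply_eq_sq, powerPotential_four (hX.mem h), powerPotential_four hinv_pos, inv_inv]
    ring
  rw [hX.turningPoints_sq] at hmem
  rcases hmem with hneg | hself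
  · exact hneg.symm
  · have hh : h ^ 2 = 0 := by
      rw [← hX.apply_eq_sq, powerPotential_four (hX.mem h), show (X h)⁻¹ = X h from hself]
      simp
    rw [show (X h)⁻¹ = X h from hself, pow_eq_zero_iff two_ne_zero |>.1 hh, neg_zero]

theorem period_powerPotential_four {E : ℝ} (hE : 0 < E) :
    period (powerPotential 4) (Ioi 0) E = π := by
  obtain ⟨X, -, hX⟩ := exists_isEnergyParametrization_powerPotential (d := 4) (by norm_num)
  have hwidth : ∀ r, 0 ≤ r → X r - X (-r) = √2 * r := fun r hr => by
    have hwidth_nonneg : 0 ≤ X r - X (-r) :=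
      sub_nonneg.2 (hX.strictMono.monotone (neg_le_self hr))
    refine (sq_eq_sq₀ hwidth_nonneg (by positivity)).1 ?_
    rw [mul_pow, sq_sqrt zero_le_two, ← hX.apply_eq_sq r, powerPotential_four (hX.mem r),
      energyParametrization_powerPotential_four_neg hX]
    ring
  rw [hX.period_eq_of_sub_eq hwidth hE, mul_div_cancel_left₀ _ (by positivity)]

theorem energyParametrization_powerPotential_iteratedDeriv_three {d : ℝ} {X : ℝ → ℝ} (hd : d ≠ 0)
    (hX : IsEnergyParametrization (powerPotential d) (Ioi 0) X) (hX4 : ContDiff ℝ 4 X) :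
    6 * iteratedDeriv 3 X 0 = deriv X 0 ^ 3 * ((d - 1) * (d - 4)) := by
  have hrpow : ∀ c p : ℝ, ∀ x ∈ Ioi (0 : ℝ), HasDerivAt (fun x => c * x ^ p)
      (c * p * x ^ (p - 1)) x := fun c p x hx => by
    simpa only [mul_assoc] using (hasDerivAt_rpow_const (p := p) (.inl hx.ne')).const_mul c
  have hjet := hX.mul_iteratedDeriv_three_zero_eq hX4
    (V₂ := fun x => 1 + (d - 1) * x ^ (-d)) (V₃ := fun x => (d - 1) * -d * x ^ (-d - 1))
    (V₄ := fun x => (d - 1) * -d * (-d - 1) * x ^ (-d - 1 - 1))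
    (fun x hx => hasDerivAt_powerPotential d hx)
    (fun x hx => by
      refine ((hasDerivAt_id' x).fun_sub
        (hasDerivAt_rpow_const (p := 1 - d) (.inl hx.ne'))).congr_deriv ?_
      rw [show 1 - d - 1 = -d by ring]
      ring)
    (fun x hx => (hrpow _ _ x hx).const_add 1) (hrpow _ _)
  simp only [hX.apply_zero_eq (mem_Ioi.2 one_pos) (powerPotential_one d), one_rpow] at hjet
  refine mul_left_cancel₀ (pow_ne_zero 2 hd) ?_
  linear_combination hjet / 2

theorem corollary3p5_general (d : ℝ) (hd : 2 ≤ d) :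
    (∀ E : ℝ, 0 < E →
      leftTurningPoint (powerPotential d) (Ioi 0) E <
        rightTurningPoint (powerPotential d) (Ioi 0) E ∧
      turningPoints (powerPotential d) (Ioi 0) E =
        {leftTurningPoint (powerPotential d) (Ioi 0) E,
          rightTurningPoint (powerPotential d) (Ioi 0) E} ∧
      IntervalIntegrable (fun x => 1 / √(2 * (E - powerPotential d x))) volume
        (leftTurningPoint (powerPotential d) (Ioi 0) E)
        (rightTurningPoint (powerPotential d) (Ioi 0) E)) ∧
    (NonconstantOnSubintervals (period (powerPotential d) (Ioi 0)) (Ioi 0) ↔ d ≠ 4) ∧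
    (d = 4 → ∀ E : ℝ, 0 < E → period (powerPotential d) (Ioi 0) E = π) := by
  obtain ⟨X, hXω, hX⟩ := exists_isEnergyParametrization_powerPotential hd
  refine ⟨fun E hE => hX.period_wellDefined hE, ⟨?_, fun hd4 => ?_⟩, ?_⟩
  · rintro hT rfl
    obtain ⟨E₁, hE₁, E₂, hE₂, hne⟩ := hT (Ioi 0) subset_rfl ordConnected_Ioi
      ⟨1, by simp, 2, by simp, by norm_num⟩
    exact hne ((period_powerPotential_four hE₁).trans (period_powerPotential_four hE₂).symm)
  · refine hX.nonconstantOnSubintervals_period hXω fun hX3 => ?_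
    have hjet := energyParametrization_powerPotential_iteratedDeriv_three (by linarith) hX
      (hXω.of_le le_top)
    have hderiv : deriv X 0 ^ 3 ≠ 0 := (pow_pos (hX.deriv_pos 0) 3).ne'
    rw [hX3, mul_zero, eq_comm] at hjet
    simp [hderiv, sub_ne_zero.2 hd4, show d - 1 ≠ 0 by linarith] at hjet
  · rintro rfl E hE
    exact period_powerPotential_four hE

theorem corollary3p5 (d : ℕ) (hd : 2 ≤ d) :
    -- the period is well defined: exactly two turning points, and a convergent integral
    (∀ E : ℝ, 0 < E →
      leftTurningPoint (potential d) (Ioi 0) E < rightTurningPoint (potential d) (Ioi 0) E ∧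
      turningPoints (potential d) (Ioi 0) E =
        {leftTurningPoint (potential d) (Ioi 0) E, rightTurningPoint (potential d) (Ioi 0) E} ∧
      IntervalIntegrable (fun x => 1 / Real.sqrt (2 * (E - potential d x))) volume
        (leftTurningPoint (potential d) (Ioi 0) E) (rightTurningPoint (potential d) (Ioi 0) E)) ∧
    (NonconstantOnSubintervals (period (potential d) (Ioi 0)) (Ioi 0) ↔ d ≠ 4) ∧
    (d = 4 → ∀ E : ℝ, 0 < E → period (potential d) (Ioi 0) E = Real.pi) := by
  rw [potential_eq_powerPotential]
  exact_mod_cast corollary3p5_general d (by exact_mod_cast hd)
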